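/- All topological spaces are $\mathsf{T}_1$ and have no isolated points; no further separation is assumed. For a subset $A$ of a space $X$ let $$\mathrm{cl}_\theta(A)=\{x\in X:\ \overline{U}\cap A\neq\emptyset\ \text{for every neighborhood } U \text{ of } x\},$$ where $\overline U$ is the closure of $U$ in $X$. For $x\in X$ let $\Omega^\theta_x=\{A\subseteq X\setminus\{x\}:\ x\in \mathrm{cl}_\theta(A)\}$. Let $t_\theta(X,x)$ be the least infinite cardinal $\lambda$ such that every $A\in\Omega^\theta_x$ contains a set $C\subseteq A$ with $|C|\le\lambda$ and $x\in \mathrm{cl}_\theta(C)$. Let $\chi_\theta(X,x)$ be the least cardinality of a family $\mathcal N$ of nonempty open sets such that for every open $U$ with $x\in U$ there is an $N\in\mathcal N$ with $x\in N\subseteq\overline U$. For families $\mathcal A,\mathcal B$ of sets, ${\sf S}_1(\mathcal A,\mathcal B)$ states that for each sequence $(A_n:n<\omega)$ of elements of $\mathcal A$ there are $b_n\in A_n$ $(n<\omega)$ with $\{b_n:n<\omega\}\in\mathcal B$. In the game ${\sf G}_1(\mathcal A,\mathcal B)$ of length $\omega$, in inning $n<\omega$ player ONE chooses $O_n\in\mathcal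 A$ and player TWO responds with some $T_n\in O_n$; TWO wins the play if $\{T_n:n<\omega\}\in\mathcal B$, and otherwise ONE wins. Let ${\sf cov}(\mathcal M)$ be the least cardinality of a family of meager subsets of the Baire space ${}^\omega\omega$ whose union is ${}^\omega\omega$ (the same cardinal is obtained with the real line in place of ${}^\omega\omega$). **Theorem.** For every infinite cardinal $\kappa$ the following are equivalent: 1. $\kappa<{\sf cov}(\mathcal M)$. 2. For each space $X$ and each point $x\in X$ with $t_\theta(X,x)=\aleph_0$ and $\chi_\theta(X,x)\le\kappa$, ONE has no winning strategy in the game ${\sf G}_1(\Omega^\theta_x,\Omega^\theta_x)$. 3. For each space $X$ and each point $x\in X$ with $t_\theta(X,x)=\aleph_0$ and $\chi_\theta(X,x)\le\kappa$, the selection principle ${\sf S}_1(\Omega^\theta_x,\Omega^\theta_x)$ holds. -/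

import Mathlib

open Set Topology
open scoped Cardinal

universe u

namespace ThetaSelection

noncomputable section

/-- The covering number of the meagre ideal: the least cardinality of a family of meagre subsets
of the Baire space `ℕ → ℕ` (the product of discrete spaces) whose union is the whole space. -/
def covMeagre : Cardinal.{0} :=
  sInf {c | ∃ F : Set (Set (ℕ → ℕ)), #F = c ∧ (∀ M ∈ F, IsMeagre M) ∧ ⋃₀ F = univ}

/-- The selection principle `S₁(𝒜, ℬ)`. -/
def SelectOne {α : Type u} (𝒜 ℬ : Set (Set α)) : Prop :=
  ∀ A : ℕ → Set α, (∀ n, A n ∈ 𝒜) → ∃ b : ℕ → α, (∀ n, b n ∈ A n) ∧ range b ∈ ℬ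

/-- A strategy for ONE in the game `G₁(𝒜, ℬ)`: it assigns to every finite sequence of previous
moves of TWO (listed in the order in which they were made) a member of `𝒜`. -/
def IsStrategyOne {α : Type u} (𝒜 : Set (Set α)) (σ : List α → Set α) : Prop :=
  ∀ s, σ s ∈ 𝒜

/-- `T` lists the moves of TWO in a play of `G₁` in which ONE follows `σ`: in inning `n`, ONE
plays `σ [T 0, …, T (n - 1)]` and TWO responds with an element `T n` of that set. -/
def IsPlayAgainst {α : Type u} (σ : List α → Set α) (T : ℕ → α) : Prop :=
  ∀ n, T n ∈ σ ((List.range n).map T)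

/-- ONE has a winning strategy in the game `G₁(𝒜, ℬ)` of length `ω`: TWO's set of moves belongs
to `ℬ` in no play in which ONE follows the strategy. -/
def OneHasWinningStrategy {α : Type u} (𝒜 ℬ : Set (Set α)) : Prop :=
  ∃ σ : List α → Set α, IsStrategyOne 𝒜 σ ∧ ∀ T : ℕ → α, IsPlayAgainst σ T → range T ∉ ℬ

variable {X : Type u} [TopologicalSpace X]

/-- The `θ`-closure of `A`: the points all of whose neighbourhoods `U` satisfy
`closure U ∩ A ≠ ∅`. -/
def thetaClosure (A : Set X) : Set X :=
  {x | ∀ U ∈ 𝓝 x, (closure U ∩ A).Nonempty}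

/-- The family `Ω^θ_x` of all `A ⊆ X \ {x}` with `x` in the `θ`-closure of `A`. -/
def thetaOmega (x : X) : Set (Set X) :=
  {A | A ⊆ {x}ᶜ ∧ x ∈ thetaClosure A}

/-- The `θ`-tightness `t_θ(X, x)`: the least infinite cardinal `c` such that every
`A ⊆ X \ {x}` with `x` in the `θ`-closure of `A` contains a set `C` of cardinality at most `c`
with `x` in the `θ`-closure of `C`. -/
def thetaTightness (x : X) : Cardinal.{u} :=
  sInf {c | ℵ₀ ≤ c ∧ ∀ A : Set X, A ⊆ {x}ᶜ → x ∈ thetaClosure A →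
    ∃ C ⊆ A, x ∈ thetaClosure C ∧ #C ≤ c}

/-- A `θ`-neighbourhood base at `x`: a family of nonempty open sets such that every open `U`
containing `x` admits a member `N` with `x ∈ N ⊆ closure U`. -/
def IsThetaNhdBase (x : X) (𝒩 : Set (Set X)) : Prop :=
  (∀ N ∈ 𝒩, IsOpen N ∧ N.Nonempty) ∧
    ∀ U : Set X, IsOpen U → x ∈ U → ∃ N ∈ 𝒩, x ∈ N ∧ N ⊆ closure U

/-- The `θ`-character `χ_θ(X, x)`: the least cardinality of a `θ`-neighbourhood base at `x`. -/
def thetaCharacter (x : X) : Cardinal.{u} :=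
  sInf {c | ∃ 𝒩 : Set (Set X), #𝒩 = c ∧ IsThetaNhdBase x 𝒩}

end

end ThetaSelection

/-! From 1 to 2: countable `θ`-tightness lets ONE's sets be thinned to countable ones, so TWO's
plays against a fixed strategy are coded by points of the Baire space. For each `N` in a `θ`-base
with `x ∈ N`, the codes of plays missing `closure N` form a meagre set; fewer than `cov(M)` such
sets leave a code of a play that TWO wins. From 2 to 3, a sequence of sets is a strategy.

From 3 to 1: given `κ` functions, a filter on a countable index set yields a space in which a
selection produces one function equal to each of them infinitely often
(`exists_infinitely_equal_of_selectOne`). Such guessing then yields a common point of `κ` dense open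
sets, built from blocks: one guess gives a sequence bounding the codes of the blocks
(`exists_strictMono`), a second gives the blocks themselves (`exists_mem_eq`). Writing each meagre
set through countably many dense open sets shows that `κ` of them do not cover. -/

namespace ThetaSelection

/-! ### Plays coded by the Baire space -/

section GameFromBaire

variable {X : Type u}

/-- The position reached after `n` innings when TWO answers at each position `s` with the element
of index `f n` in the enumeration `c s`. -/
def playHistory (c : List X → ℕ → X) (f : ℕ → ℕ) : ℕ → List X
  | 0 => []
  | n + 1 => playHistory c f n ++ [c (playHistory c f n) (f n)]

/-- The moves of TWO in the play described by `playHistory`. -/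
def playMove (c : List X → ℕ → X) (f : ℕ → ℕ) (n : ℕ) : X :=
  c (playHistory c f n) (f n)

theorem map_playMove (c : List X → ℕ → X) (f : ℕ → ℕ) (n : ℕ) :
    (List.range n).map (playMove c f) = playHistory c f n := by
  induction n with
  | zero => rfl
  | succ n ih => simp [List.range_succ, ih, playHistory, playMove]

theorem playHistory_congr (c : List X → ℕ → X) {f g : ℕ → ℕ} {n : ℕ}
    (h : ∀ i < n, f i = g i) : playHistory c f n = playHistory c g n := by
  induction n with
  | zero => rfl
  | succ n ih =>
    rw [playHistory, playHistory, ih fun i hi => h i (by omega), h n (by omega)]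

theorem isLocallyConstant_eval (n : ℕ) : IsLocallyConstant fun f : ℕ → ℕ => f n :=
  (IsLocallyConstant.iff_continuous _).2 (continuous_apply n)

theorem isLocallyConstant_playHistory (c : List X → ℕ → X) (n : ℕ) :
    IsLocallyConstant fun f => playHistory c f n := by
  induction n with
  | zero => exact IsLocallyConstant.const _
  | succ n ih =>
    exact (ih.prodMk (isLocallyConstant_eval n)).comp fun p => p.1 ++ [c p.1 p.2]

theorem isLocallyConstant_playMove (c : List X → ℕ → X) (n : ℕ) :
    IsLocallyConstant fun f => playMove c f n :=
  ((isLocallyConstant_playHistory c n).prodMk (isLocallyConstant_eval n)).comp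
    fun p => c p.1 p.2

/-- A neighbourhood of a point of the Baire space contains all points that agree with it on a
sufficiently long initial segment. -/
theorem exists_initialSegment_subset {U : Set (ℕ → ℕ)} (hU : IsOpen U) {f : ℕ → ℕ} (hf : f ∈ U) :
    ∃ n, ∀ g : ℕ → ℕ, (∀ i < n, g i = f i) → g ∈ U := by
  obtain ⟨I, u, hu, hsub⟩ := isOpen_pi_iff.1 hU f hf
  obtain ⟨n, hn⟩ := I.exists_nat_subset_range
  refine ⟨n, fun g hg => hsub fun i hi => ?_⟩
  rw [hg i (Finset.mem_range.1 (hn hi))]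
  exact (hu i hi).2

/-- The complement is open, since each move depends on finitely many coordinates, and dense, since
after any initial segment the next coordinate can be chosen to put a move in `K`. -/
theorem isMeagre_setOf_playMove_notMem (c : List X → ℕ → X) {K : Set X}
    (hK : ∀ s, ∃ m, c s m ∈ K) : IsMeagre {f : ℕ → ℕ | ∀ n, playMove c f n ∉ K} := by
  have hopen : IsOpen {f : ℕ → ℕ | ∃ n, playMove c f n ∈ K} := by
    rw [ofPred_exists]
    exact isOpen_iUnion fun n => isLocallyConstant_playMove c n K
  have hdense : Dense {f : ℕ → ℕ | ∃ n, playMove c f n ∈ K} := by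
    refine dense_iff_inter_open.2 fun U hU ⟨f, hf⟩ => ?_
    obtain ⟨n, hn⟩ := exists_initialSegment_subset hU hf
    obtain ⟨m, hm⟩ := hK (playHistory c f n)
    have hagree : ∀ i < n, Function.update f n m i = f i := fun i hi =>
      Function.update_of_ne hi.ne _ _
    refine ⟨Function.update f n m, hn _ hagree, n, ?_⟩
    rwa [playMove, playHistory_congr c hagree, Function.update_self]
  have := residual_of_dense_open hopen hdense
  rw [IsMeagre]
  convert this using 1
  ext f
  simp

end GameFromBaire

/-! ### Tightness, character and ONE's strategies -/

section

variable {X : Type u} [TopologicalSpace X] {x : X}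

theorem exists_countable_of_thetaTightness_eq (h : thetaTightness x = ℵ₀) {A : Set X}
    (hA : A ∈ thetaOmega x) : ∃ C ⊆ A, x ∈ thetaClosure C ∧ C.Countable := by
  have hne : {c : Cardinal.{u} | ℵ₀ ≤ c ∧ ∀ A : Set X, A ⊆ {x}ᶜ → x ∈ thetaClosure A →
      ∃ C ⊆ A, x ∈ thetaClosure C ∧ #C ≤ c}.Nonempty := by
    -- The infimum of the empty set is `0`, which is not `ℵ₀`.
    by_contra hne
    rw [thetaTightness, not_nonempty_iff_eq_empty.1 hne, Cardinal.sInf_empty] at h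
    exact Cardinal.aleph0_ne_zero h.symm
  have hmem := csInf_mem hne
  obtain ⟨C, hC, hxC, hcard⟩ := hmem.2 A hA.1 hA.2
  refine ⟨C, hC, hxC, Cardinal.le_aleph0_iff_set_countable.1 (hcard.trans (le_of_eq h))⟩

theorem thetaTightness_eq_aleph0_of_countable [Countable X] (x : X) :
    thetaTightness x = ℵ₀ := by
  refine le_antisymm (csInf_le' ⟨le_rfl, fun A _ hA => ⟨A, Subset.rfl, hA, ?_⟩⟩)
    (le_csInf ⟨max ℵ₀ #X, le_max_left _ _, fun A _ hA => ⟨A, Subset.rfl, hA, ?_⟩⟩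
      fun c hc => hc.1)
  · exact Cardinal.mk_le_aleph0
  · exact (Cardinal.mk_set_le A).trans (le_max_right _ _)

theorem exists_isThetaNhdBase (x : X) :
    ∃ 𝒩 : Set (Set X), #𝒩 = thetaCharacter x ∧ IsThetaNhdBase x 𝒩 :=
  csInf_mem (s := {c | ∃ 𝒩 : Set (Set X), #𝒩 = c ∧ IsThetaNhdBase x 𝒩})
    ⟨_, {U | IsOpen U ∧ U.Nonempty}, rfl, fun _ h => h,
      fun U hU hx => ⟨U, ⟨hU, x, hx⟩, hx, subset_closure⟩⟩

theorem exists_range_eq_of_mem_thetaClosure {C : Set X} (hC : C.Countable)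
    (hx : x ∈ thetaClosure C) : ∃ c : ℕ → X, C = range c :=
  hC.exists_eq_range ((hx univ Filter.univ_mem).mono inter_subset_right)

theorem not_oneHasWinningStrategy_of_lt_covMeagre {κ : Cardinal.{u}}
    (hκ : κ < Cardinal.lift.{u, 0} covMeagre) (ht : thetaTightness x = ℵ₀)
    (hχ : thetaCharacter x ≤ κ) :
    ¬ OneHasWinningStrategy (thetaOmega x) (thetaOmega x) := by
  rintro ⟨σ, hσ, hwin⟩
  choose C hCσ hxC hCc using fun s => exists_countable_of_thetaTightness_eq ht (hσ s)
  choose c hc using fun s => exists_range_eq_of_mem_thetaClosure (hCc s) (hxC s)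
  have hcσ : ∀ s m, c s m ∈ σ s := fun s m => hCσ s (hc s ▸ mem_range_self m)
  obtain ⟨𝒩, hcard, h𝒩, hbase⟩ := exists_isThetaNhdBase x
  set miss : Set X → Set (ℕ → ℕ) := fun N => {f | ∀ n, playMove c f n ∉ closure N} with hmiss
  have hF : ⋃₀ (miss '' {N ∈ 𝒩 | x ∈ N}) ≠ univ := by
    intro hcover
    have hle : covMeagre ≤ #(miss '' {N ∈ 𝒩 | x ∈ N}) := by
      refine csInf_le' ⟨_, rfl, ?_, hcover⟩
      rintro _ ⟨N, ⟨hN, hxN⟩, rfl⟩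
      refine isMeagre_setOf_playMove_notMem c fun s => ?_
      obtain ⟨y, hyN, hy⟩ := hxC s N ((h𝒩 N hN).1.mem_nhds hxN)
      rw [hc s] at hy
      obtain ⟨m, rfl⟩ := hy
      exact ⟨m, hyN⟩
    refine hκ.not_ge ((Cardinal.lift_le.2 hle).trans ?_)
    have himage := Cardinal.mk_image_le_lift (f := miss) (s := {N ∈ 𝒩 | x ∈ N})
    rw [Cardinal.lift_id'.{0, u}] at himage
    exact himage.trans ((Cardinal.mk_le_mk_of_subset (sep_subset _ _)).trans (hcard.trans_le hχ))
  obtain ⟨f, hf⟩ := (ne_univ_iff_exists_notMem _).1 hF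
  refine hwin (playMove c f) (fun n => ?_) ⟨?_, fun U hU => ?_⟩
  · rw [map_playMove]
    exact hcσ _ _
  · rintro _ ⟨n, rfl⟩
    exact (hσ _).1 (hcσ _ _)
  · obtain ⟨V, hVU, hV, hxV⟩ := mem_nhds_iff.1 hU
    obtain ⟨N, hN, hxN, hNV⟩ := hbase V hV hxV
    by_contra hempty
    refine hf ⟨miss N, ⟨N, ⟨hN, hxN⟩, rfl⟩, fun n hn => hempty ⟨_, ?_, mem_range_self n⟩⟩
    exact closure_mono hVU (closure_minimal hNV isClosed_closure hn)

end

/-- A sequence without a good selection is a winning strategy that looks only at the inning number.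
-/
theorem selectOne_of_not_oneHasWinningStrategy {α : Type u} {𝒜 ℬ : Set (Set α)}
    (h : ¬ OneHasWinningStrategy 𝒜 ℬ) : SelectOne 𝒜 ℬ := by
  intro A hA
  by_contra hsel
  refine h ⟨fun s => A s.length, fun s => hA _, fun T hT hTB => hsel ⟨T, fun n => ?_, hTB⟩⟩
  simpa using hT n

/-! ### The space of a filter -/

section FilterSpace

/-- The space obtained from the topological sum of copies of `ℚ` indexed by `D` by adding a point
whose neighbourhoods contain the copies with index in a member of a filter on `D`. -/
def FilterSpace {D : Type u} (_ : Filter D) : Type u := Option (D × ℚ)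

variable {D : Type u} {l : Filter D}

instance [Countable D] : Countable (FilterSpace l) :=
  inferInstanceAs (Countable (Option (D × ℚ)))

instance : TopologicalSpace (FilterSpace l) where
  IsOpen V := (∀ d, IsOpen {q : ℚ | (some (d, q) : Option (D × ℚ)) ∈ V}) ∧
    ((none : Option (D × ℚ)) ∈ V → ∀ᶠ d in l, ∀ q : ℚ, (some (d, q) : Option (D × ℚ)) ∈ V)
  isOpen_univ := ⟨fun _ => isOpen_univ, fun _ => Filter.Eventually.of_forall fun _ _ => trivial⟩
  isOpen_inter V W hV hW := ⟨fun d => (hV.1 d).inter (hW.1 d), fun h => by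
    filter_upwards [hV.2 h.1, hW.2 h.2] with d h₁ h₂ q using ⟨h₁ q, h₂ q⟩⟩
  isOpen_sUnion S hS := by
    refine ⟨fun d => ?_, fun ⟨V, hV, hx⟩ => ?_⟩
    · have : {q : ℚ | (some (d, q) : Option (D × ℚ)) ∈ ⋃₀ S} =
          ⋃ V ∈ S, {q : ℚ | (some (d, q) : Option (D × ℚ)) ∈ V} := by
        ext q
        simp only [mem_iUnion, exists_prop]
        exact Iff.rfl
      rw [this]
      exact isOpen_biUnion fun V hV => (hS V hV).1 d
    · filter_upwards [(hS V hV).2 hx] with d hd q using ⟨V, hV, hd q⟩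

namespace FilterSpace

/-- The added point of `FilterSpace l`. -/
def infty (l : Filter D) : FilterSpace l := (none : Option (D × ℚ))

/-- The point `q` of the copy of `ℚ` with index `d`. -/
def point (l : Filter D) (d : D) (q : ℚ) : FilterSpace l := (some (d, q) : Option (D × ℚ))

theorem point_ne_infty (d : D) (q : ℚ) : point l d q ≠ infty l := Option.some_ne_none _

theorem point_injective {d d' : D} {q q' : ℚ} (h : point l d q = point l d' q') :
    d = d' ∧ q = q' := by
  simpa using Option.some_injective _ h

theorem isOpen_iff {V : Set (FilterSpace l)} :
    IsOpen V ↔ (∀ d, IsOpen {q : ℚ | point l d q ∈ V}) ∧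
      (infty l ∈ V → ∀ᶠ d in l, ∀ q : ℚ, point l d q ∈ V) := Iff.rfl

theorem eq_infty_or_eq_point (y : FilterSpace l) : y = infty l ∨ ∃ d q, y = point l d q := by
  rcases y with _ | ⟨d, q⟩
  · exact Or.inl rfl
  · exact Or.inr ⟨d, q, rfl⟩

/-- The basic neighbourhood of the added point given by a set of indices. -/
def nhdSet (l : Filter D) (W : Set D) : Set (FilterSpace l) :=
  {y | ∀ d q, y = point l d q → d ∈ W}

theorem infty_mem_nhdSet (W : Set D) : infty l ∈ nhdSet l W :=
  fun _ _ h => absurd h.symm (point_ne_infty _ _)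

theorem point_mem_nhdSet {W : Set D} {d : D} {q : ℚ} : point l d q ∈ nhdSet l W ↔ d ∈ W :=
  ⟨fun h => h d q rfl, fun h _ _ h' => (point_injective h').1 ▸ h⟩

theorem isOpen_nhdSet {W : Set D} (hW : W ∈ l) : IsOpen (nhdSet l W) := by
  refine isOpen_iff.2 ⟨fun d => ?_, fun _ => ?_⟩
  · simp only [point_mem_nhdSet]
    exact isOpen_const
  · filter_upwards [hW] with d hd q using point_mem_nhdSet.2 hd

/-- The complement omits the added point, so the filter imposes no condition on it. The basic
neighbourhoods are thus clopen, and taking closures in the `θ`-closure changes nothing at that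
point. -/
theorem isClosed_nhdSet (W : Set D) : IsClosed (nhdSet l W) := by
  refine isOpen_compl_iff.1 (isOpen_iff.2 ⟨fun d => ?_, fun h => absurd (infty_mem_nhdSet W) h⟩)
  simp only [mem_compl_iff, point_mem_nhdSet]
  exact isOpen_const

theorem exists_nhdSet_subset {U : Set (FilterSpace l)} (hU : U ∈ 𝓝 (infty l)) :
    ∃ W ∈ l, nhdSet l W ⊆ U := by
  obtain ⟨V, hVU, hV, hx⟩ := mem_nhds_iff.1 hU
  refine ⟨{d | ∀ q, point l d q ∈ V}, (isOpen_iff.1 hV).2 hx, fun y hy => hVU ?_⟩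
  rcases eq_infty_or_eq_point y with rfl | ⟨d, q, rfl⟩
  · exact hx
  · exact point_mem_nhdSet.1 hy q

theorem t1Space (hl : l ≤ Filter.cofinite) : T1Space (FilterSpace l) := by
  refine ⟨fun y => isOpen_compl_iff.1 (isOpen_iff.2 ⟨fun d => ?_, fun _ => ?_⟩)⟩
  · rcases eq_infty_or_eq_point y with rfl | ⟨d', q', rfl⟩
    · simp [point_ne_infty]
    · by_cases hd : d = d'
      · subst hd
        convert (isClosed_singleton (x := q')).isOpen_compl using 1
        ext q
        exact not_congr ⟨fun h => (point_injective h).2, fun h => congrArg _ h⟩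
      · convert isOpen_univ using 1
        exact eq_univ_of_forall fun q h => hd (point_injective h).1
  · rcases eq_infty_or_eq_point y with rfl | ⟨d', q', rfl⟩
    · exact Filter.Eventually.of_forall fun d q => point_ne_infty d q
    · filter_upwards [hl (finite_singleton d').compl_mem_cofinite] with d hd q h
      exact hd (point_injective h).1

theorem not_isOpen_singleton [l.NeBot] (y : FilterSpace l) : ¬ IsOpen ({y} : Set (FilterSpace l)) := by
  intro h
  rcases eq_infty_or_eq_point y with rfl | ⟨d, q, rfl⟩
  · obtain ⟨d, hd⟩ := ((isOpen_iff.1 h).2 rfl).exists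
    exact point_ne_infty d 0 (hd 0)
  · refine _root_.not_isOpen_singleton q ?_
    convert (isOpen_iff.1 h).1 d using 1
    ext q'
    exact ⟨fun h => congrArg _ h, fun h => (point_injective h).2⟩

theorem mem_thetaClosure_infty {A : Set (FilterSpace l)} :
    infty l ∈ thetaClosure A ↔ ∀ W ∈ l, (nhdSet l W ∩ A).Nonempty := by
  refine ⟨fun h W hW => ?_, fun h U hU => ?_⟩
  · simpa only [(isClosed_nhdSet W).closure_eq] using
      h _ ((isOpen_nhdSet hW).mem_nhds (infty_mem_nhdSet W))
  · obtain ⟨W, hW, hWU⟩ := exists_nhdSet_subset hU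
    exact (h W hW).mono (inter_subset_inter_left _ (hWU.trans subset_closure))

theorem thetaCharacter_infty_le {ι : Type u} {p : ι → Prop} {s : ι → Set D}
    (h : l.HasBasis p s) : thetaCharacter (infty l) ≤ #ι := by
  have hbase : IsThetaNhdBase (infty l) ((fun i => nhdSet l (s i)) '' {i | p i}) := by
    refine ⟨?_, fun U hU hx => ?_⟩
    · rintro _ ⟨i, hi, rfl⟩
      exact ⟨isOpen_nhdSet (h.mem_of_mem hi), _, infty_mem_nhdSet _⟩
    · obtain ⟨W, hW, hWU⟩ := exists_nhdSet_subset (hU.mem_nhds hx)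
      obtain ⟨i, hi, hiW⟩ := h.mem_iff.1 hW
      exact ⟨_, ⟨i, hi, rfl⟩, infty_mem_nhdSet _,
        fun y hy => subset_closure (hWU fun d q hd => hiW (hy d q hd))⟩
  have hle : thetaCharacter (infty l) ≤ #((fun i => nhdSet l (s i)) '' {i | p i}) :=
    csInf_le' ⟨_, rfl, hbase⟩
  exact hle.trans (Cardinal.mk_image_le.trans (Cardinal.mk_set_le _))

end FilterSpace

end FilterSpace

/-! ### From selections to infinitely often equal functions -/

section InfinitelyEqual

variable {ι : Type u}

/-- The index set of the spaces that turn a selection into a guessing function. -/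
abbrev GuessIndex : Type u := ULift.{u} (ℕ × List ℕ)

/-- The indices `(n, p)` outside `E` such that the finite sequence `p` meets each of the functions
`j ↦ f i (Nat.pair n j)` with `i ∈ S`. -/
def guessSet (f : ι → ℕ → ℕ) (P : Finset ι × Finset GuessIndex.{u}) : Set GuessIndex.{u} :=
  {d | d ∉ P.2 ∧ ∀ i ∈ P.1, ∃ j, d.down.2[j]? = some (f i (Nat.pair d.down.1 j))}

theorem guessSet_anti (f : ι → ℕ → ℕ) {P Q : Finset ι × Finset GuessIndex.{u}} (h : P ≤ Q) :
    guessSet f Q ⊆ guessSet f P :=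
  fun _ hd => ⟨fun hE => hd.1 (h.2 hE), fun i hi => hd.2 i (h.1 hi)⟩

/-- The filter generated by the sets `guessSet f P`. -/
def guessFilter (f : ι → ℕ → ℕ) : Filter GuessIndex.{u} :=
  ⨅ P, Filter.principal (guessSet f P)

theorem hasBasis_guessFilter (f : ι → ℕ → ℕ) :
    (guessFilter f).HasBasis (fun _ => True) (guessSet f) := by
  classical
  exact Filter.hasBasis_iInf_principal fun P Q =>
    ⟨P ⊔ Q, guessSet_anti f le_sup_left, guessSet_anti f le_sup_right⟩

theorem guessFilter_le_cofinite (f : ι → ℕ → ℕ) : guessFilter f ≤ Filter.cofinite := by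
  intro s hs
  refine (hasBasis_guessFilter f).mem_iff.2 ⟨(∅, (Filter.mem_cofinite.1 hs).toFinset), trivial,
    fun d hd => ?_⟩
  by_contra hds
  exact hd.1 (by simpa using hds)

theorem exists_list_meeting (f : ι → ℕ → ℕ) (n L : ℕ) (S : Finset ι) :
    ∃ p : List ℕ, L ≤ p.length ∧ ∀ i ∈ S, ∃ j, p[j]? = some (f i (Nat.pair n j)) := by
  classical
  induction S using Finset.induction_on with
  | empty => exact ⟨List.replicate L 0, by simp, by simp⟩
  | insert i S _ ih =>
    obtain ⟨p, hL, hp⟩ := ih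
    refine ⟨p ++ [f i (Nat.pair n p.length)], by simp; omega, fun i' hi' => ?_⟩
    rcases Finset.mem_insert.1 hi' with rfl | hi'
    · exact ⟨p.length, by simp⟩
    · obtain ⟨j, hj⟩ := hp i' hi'
      exact ⟨j, by rw [List.getElem?_append_left (List.getElem?_eq_some_iff.1 hj).1, hj]⟩

theorem exists_mem_guessSet (f : ι → ℕ → ℕ) (P : Finset ι × Finset GuessIndex.{u}) (n : ℕ) :
    ∃ p, ULift.up (n, p) ∈ guessSet f P := by
  -- A list longer than all those occurring in `P.2` avoids this finite set.
  obtain ⟨p, hL, hp⟩ := exists_list_meeting f n (P.2.sup (fun d => d.down.2.length) + 1) P.1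
  refine ⟨p, fun hE => ?_, hp⟩
  have := Finset.le_sup (f := fun d : GuessIndex.{u} => d.down.2.length) hE
  simp only at this
  omega

instance (f : ι → ℕ → ℕ) : (guessFilter f).NeBot :=
  (hasBasis_guessFilter f).neBot_iff.2 fun {P} _ =>
    let ⟨_, hp⟩ := exists_mem_guessSet f P 0
    ⟨_, hp⟩

theorem mk_guessBasis_le {κ : Cardinal.{u}} (hκ : ℵ₀ ≤ κ) (hι : #ι ≤ κ) :
    #(Finset ι × Finset GuessIndex.{u}) ≤ κ := by
  have h₁ : #(Finset ι) ≤ κ := by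
    rcases finite_or_infinite ι with h | h
    · exact (Cardinal.lt_aleph0_of_finite _).le.trans hκ
    · rwa [Cardinal.mk_finset_of_infinite]
  have h₂ : #(Finset GuessIndex.{u}) ≤ κ := Cardinal.mk_le_aleph0.trans hκ
  rw [Cardinal.mk_prod, Cardinal.lift_id, Cardinal.lift_id]
  exact Cardinal.mul_le_of_le hκ h₁ h₂

/-- A family of functions is guessed infinitely often by a single function as soon as the
selection principle holds at the added point of the associated space. -/
theorem exists_infinitely_equal_of_selectOne (f : ι → ℕ → ℕ)
    (h : SelectOne (thetaOmega (FilterSpace.infty (guessFilter f)))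
      (thetaOmega (FilterSpace.infty (guessFilter f)))) :
    ∃ g : ℕ → ℕ, ∀ i, {n | f i n = g n}.Infinite := by
  classical
  obtain ⟨b, hb, hbΩ⟩ := h
    (fun n => range fun p => FilterSpace.point (guessFilter f) (ULift.up (n, p)) 0) fun n => by
      refine ⟨?_, FilterSpace.mem_thetaClosure_infty.2 fun W hW => ?_⟩
      · rintro _ ⟨p, rfl⟩
        exact FilterSpace.point_ne_infty _ _
      · obtain ⟨P, -, hP⟩ := (hasBasis_guessFilter f).mem_iff.1 hW
        obtain ⟨p, hp⟩ := exists_mem_guessSet f P n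
        exact ⟨_, FilterSpace.point_mem_nhdSet.2 (hP hp), p, rfl⟩
  choose p hp using hb
  have hinf : ∀ i, {n | ∃ j, (p n)[j]? = some (f i (Nat.pair n j))}.Infinite := by
    intro i hfin
    -- The excluded finite set consists of all selected indices that meet `f i`; the neighbourhood
    -- then contains no selected point.
    obtain ⟨_, hy, n, rfl⟩ := FilterSpace.mem_thetaClosure_infty.1 hbΩ.2 _
      ((hasBasis_guessFilter f).mem_of_mem
        (i := ({i}, hfin.toFinset.image fun n => ULift.up (n, p n))) trivial)
    rw [← hp n, FilterSpace.point_mem_nhdSet] at hy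
    obtain ⟨hE, hmeet⟩ := hy
    exact hE (Finset.mem_image.2 ⟨n, hfin.mem_toFinset.2 (hmeet i (by simp)), rfl⟩)
  refine ⟨fun m => (p m.unpair.1)[m.unpair.2]?.getD 0, fun i => ?_⟩
  refine Infinite.of_image (fun m => m.unpair.1) ((hinf i).mono ?_)
  rintro n ⟨j, hj⟩
  exact ⟨Nat.pair n j, by simp [hj], by simp⟩

end InfinitelyEqual

/-! ### From guessing to a common point of dense open sets -/

section PointInDenseOpenSets

variable {ι : Type u}

/-- The points of the Baire space that extend the finite sequence `s`. -/
def listCylinder (s : List ℕ) : Set (ℕ → ℕ) := {x | ∀ m v, s[m]? = some v → x m = v}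

theorem exists_forall_mem_listCylinder {S : ℕ → List ℕ} (hS : ∀ n, S n <+: S (n + 1)) :
    ∃ x, ∀ n, x ∈ listCylinder (S n) := by
  have hmono : ∀ n k, S n <+: S (n + k) := by
    intro n k
    induction k with
    | zero => exact List.prefix_rfl
    | succ k ih => exact ih.trans (hS _)
  have hagree : ∀ {n n' m v v' : ℕ}, n ≤ n' → (S n)[m]? = some v → (S n')[m]? = some v' → v = v' := by
    intro n n' m v v' hle h h'
    obtain ⟨k, rfl⟩ := Nat.exists_eq_add_of_le hle
    obtain ⟨t, ht⟩ := hmono n k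
    rw [← ht, List.getElem?_append_left (List.getElem?_eq_some_iff.1 h).1, h] at h'
    exact Option.some_injective _ h'
  have hval : ∀ m : ℕ, ∃ v, ∀ n w, (S n)[m]? = some w → v = w := by
    intro m
    by_cases hm : ∃ n v, (S n)[m]? = some v
    · obtain ⟨n, v, hv⟩ := hm
      refine ⟨v, fun n' w hw => ?_⟩
      rcases le_total n n' with hle | hle
      · exact hagree hle hv hw
      · exact (hagree hle hw hv).symm
    · push Not at hm
      exact ⟨0, fun n w hw => absurd hw (hm n w)⟩
  choose x hx using hval
  exact ⟨x, fun n m v hv => hx m n v hv⟩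

theorem exists_listCylinder_append_subset {U : Set (ℕ → ℕ)} (hU : IsOpen U) (hd : Dense U)
    (s : List ℕ) : ∃ q, listCylinder (s ++ q) ⊆ U := by
  have hopen : IsOpen {x : ℕ → ℕ | ∀ i < s.length, x i = s[i]?.getD 0} := by
    simp only [ofPred_forall]
    exact (finite_lt_nat s.length).isOpen_biInter fun i _ =>
      isLocallyConstant_eval i {v | v = s[i]?.getD 0}
  obtain ⟨x, hxs, hxU⟩ := hd.inter_open_nonempty _ hopen ⟨fun i => s[i]?.getD 0, fun _ _ => rfl⟩
  obtain ⟨n, hn⟩ := exists_initialSegment_subset hU hxU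
  refine ⟨(List.range n).map fun i => x (s.length + i), fun y hy => hn y fun i hi => ?_⟩
  refine hy i (x i) ?_
  rcases lt_or_ge i s.length with his | his
  · rw [List.getElem?_append_left his, hxs i his, List.getElem?_eq_getElem his]
    rfl
  · rw [List.getElem?_append_right his, List.getElem?_map, List.getElem?_range (by omega)]
    simp [Nat.add_sub_cancel' his]

theorem listCylinder_append_subset (s t : List ℕ) : listCylinder (s ++ t) ⊆ listCylinder s :=
  fun _ hx m v hv => hx m v
    (by rw [List.getElem?_append_left (List.getElem?_eq_some_iff.1 hv).1, hv])

/-- Prolonging `q` only shrinks the cylinders, so the sequences in `S` can be treated one at a time.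
-/
theorem exists_forall_listCylinder_append_subset {U : Set (ℕ → ℕ)} (hU : IsOpen U)
    (hd : Dense U) (S : Finset (List ℕ)) : ∃ q, ∀ s ∈ S, listCylinder (s ++ q) ⊆ U := by
  classical
  induction S using Finset.induction_on with
  | empty => exact ⟨[], by simp⟩
  | insert s S _ ih =>
    obtain ⟨q, hq⟩ := ih
    obtain ⟨r, hr⟩ := exists_listCylinder_append_subset hU hd (s ++ q)
    refine ⟨q ++ r, fun t ht => ?_⟩
    rw [← List.append_assoc]
    rcases Finset.mem_insert.1 ht with rfl | ht
    · exact hr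
    · exact (listCylinder_append_subset _ _).trans (hq t ht)

/-- The finitely many finite sequences with code at most `k`. -/
noncomputable def codeBall (k : ℕ) : Finset (List ℕ) :=
  ((finite_le_nat k).preimage (f := Encodable.encode (α := List ℕ))
    Encodable.encode_injective.injOn).toFinset

theorem mem_codeBall {k : ℕ} {s : List ℕ} : s ∈ codeBall k ↔ Encodable.encode s ≤ k := by
  simp [codeBall]

theorem exists_monotone_code_bound (q : ℕ → List ℕ) : ∃ h : ℕ → ℕ, Monotone h ∧
    ∀ k s, Encodable.encode s ≤ k → Encodable.encode (s ++ q k) ≤ h k := by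
  refine ⟨partialSups fun k => (codeBall k).sup fun s => Encodable.encode (s ++ q k),
    partialSups_monotone _, fun k s hs => ?_⟩
  exact (Finset.le_sup (f := fun s => Encodable.encode (s ++ q k)) (mem_codeBall.2 hs)).trans
    (le_partialSups (fun k => (codeBall k).sup fun s => Encodable.encode (s ++ q k)) k)

/-- Every family of functions on `ℕ` indexed by `ι` is guessed infinitely often by a single
function. -/
def InfinitelyGuessed (ι : Type u) : Prop :=
  ∀ f : ι → ℕ → ℕ, ∃ g : ℕ → ℕ, ∀ i, {n | f i n = g n}.Infinite

/-- If all families indexed by `ι` are guessed, then monotone functions indexed by `ι` are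
infinitely often bounded by the steps of one increasing sequence. -/
theorem InfinitelyGuessed.exists_strictMono (H : InfinitelyGuessed ι) {h : ι → ℕ → ℕ}
    (hmono : ∀ i, Monotone (h i)) (a : ℕ) :
    ∃ k : ℕ → ℕ, StrictMono k ∧ k 0 = a ∧ ∀ i, {n | h i (k n) ≤ k (n + 1)}.Infinite := by
  obtain ⟨g, hg⟩ := H fun i n => h i (h i n)
  -- Partial suprema make `e` monotone and above `g`; the summand `n + 1` makes its iterates
  -- strictly increase.
  set e : ℕ → ℕ := fun n => partialSups g n + n + 1 with he
  have he_mono : Monotone e := fun m n hmn => by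
    have := partialSups_monotone g hmn
    simp only [he]
    omega
  have hge : ∀ n, g n ≤ e n := fun n => by
    have : g n ≤ partialSups g n := le_partialSups_of_le g le_rfl
    simp only [he]
    omega
  set k : ℕ → ℕ := fun n => e^[n] a with hk
  have hk_succ : ∀ n, k (n + 1) = e (k n) := fun n => Function.iterate_succ_apply' e n a
  have hk_mono : StrictMono k := strictMono_nat_of_lt_succ fun n => by
    rw [hk_succ]
    simp only [he]
    omega
  refine ⟨k, hk_mono, rfl, fun i => infinite_of_forall_exists_gt fun N => ?_⟩
  obtain ⟨m, hm, hNm⟩ := (hg i).exists_gt (k (N + 1))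
  have hex : ∃ n, m < k n := ⟨m + 1, (Nat.lt_succ_self m).trans_le (hk_mono.id_le _)⟩
  obtain ⟨n, hn⟩ : ∃ n, Nat.find hex = n + 1 := by
    refine Nat.exists_eq_succ_of_ne_zero fun h0 => ?_
    have := Nat.find_spec hex
    rw [h0] at this
    have := hk_mono.monotone (Nat.zero_le (N + 1))
    omega
  have hmn : m < k (n + 1) := hn ▸ Nat.find_spec hex
  have hnm : k n ≤ m := not_lt.1 (Nat.find_min hex (by omega))
  have hNn : N < n := Nat.lt_succ_iff.1 (hk_mono.lt_iff_lt.1 (hNm.trans hmn))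
  -- Here `k n ≤ m < k (n + 1)` and `h i (h i m) = g m`. Either the step from `k n` already bounds
  -- `h i`, or `h i m` exceeds `k (n + 1)` and the next step does.
  rcases le_or_gt (h i m) (k (n + 1)) with hle | hlt
  · exact ⟨n, (hmono i hnm).trans hle, hNn⟩
  · refine ⟨n + 1, ?_, hNn.trans n.lt_succ_self⟩
    calc h i (k (n + 1)) ≤ h i (h i m) := hmono i hlt.le
      _ = g m := hm
      _ ≤ e m := hge m
      _ ≤ e (k (n + 1)) := he_mono hmn.le
      _ = k (n + 1 + 1) := (hk_succ _).symm

/-- If all families indexed by `ι` are guessed, then partial functions with infinite domains are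
guessed at some point of their domains. -/
theorem InfinitelyGuessed.exists_mem_eq (H : InfinitelyGuessed ι) {β : Type*} [Encodable β]
    [Inhabited β] {Y : ι → Set ℕ} (hY : ∀ i, (Y i).Infinite) (f : ι → ℕ → β) :
    ∃ G : ℕ → β, ∀ i, ∃ n ∈ Y i, G n = f i n := by
  classical
  choose T hTY hT using fun i j => (hY i).exists_subset_card_eq (j + 1)
  obtain ⟨g, hg⟩ := H fun i j => Encodable.encode ((T i j).image fun n => (n, f i n))
  set A : ℕ → Finset (ℕ × β) := fun j => (Encodable.decode (g j)).getD ∅ with hA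
  -- The guess `A j` may be too small; the default range keeps at least `j + 1` elements, which is
  -- what Hall's condition needs.
  set t : ℕ → Finset ℕ := fun j =>
    if j + 1 ≤ ((A j).image Prod.fst).card then (A j).image Prod.fst else Finset.range (j + 1)
    with ht
  have ht_card : ∀ j, j + 1 ≤ (t j).card := fun j => by
    simp only [ht]
    split_ifs with h
    · exact h
    · simp
  obtain ⟨ν, hν, hνt⟩ := (Finset.all_card_le_biUnion_card_iff_exists_injective t).1 fun s => by
    rcases s.eq_empty_or_nonempty with rfl | hs
    · simp
    · have hsub : s ⊆ Finset.range (s.max' hs + 1) := fun j hj =>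
        Finset.mem_range.2 (Nat.lt_succ_of_le (s.le_max' j hj))
      calc s.card ≤ s.max' hs + 1 := by simpa using Finset.card_le_card hsub
        _ ≤ (t (s.max' hs)).card := ht_card _
        _ ≤ (s.biUnion t).card :=
          Finset.card_le_card (Finset.subset_biUnion_of_mem t (s.max'_mem hs))
  -- Since `ν` is injective, at most one `j` prescribes the value at `n`, so the guessed graphs
  -- cannot conflict.
  have hval : ∀ n, ∃ b : β, ∀ j, ν j = n → n ∈ (A j).image Prod.fst → (n, b) ∈ A j := by
    intro n
    by_cases hn : ∃ j, ν j = n ∧ n ∈ (A j).image Prod.fst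
    · obtain ⟨j, hj, hmem⟩ := hn
      obtain ⟨⟨_, b⟩, hb, rfl⟩ := Finset.mem_image.1 hmem
      exact ⟨b, fun j' hj' _ => hν (hj'.trans hj.symm) ▸ hb⟩
    · exact ⟨default, fun j hj hmem => absurd ⟨j, hj, hmem⟩ hn⟩
  choose G hG using hval
  refine ⟨G, fun i => ?_⟩
  obtain ⟨j, hj⟩ := (hg i).nonempty
  have hAj : A j = (T i j).image fun n => (n, f i n) := by
    simp only [hA]
    rw [← show _ = g j from hj, Encodable.encodek]
    rfl
  have hfst : (A j).image Prod.fst = T i j := by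
    rw [hAj, Finset.image_image]
    exact Finset.image_id
  have htj : t j = T i j := by
    simp only [ht, hfst, hT, le_refl, if_true]
  have hmem : ν j ∈ T i j := htj ▸ hνt j
  refine ⟨ν j, hTY i j hmem, ?_⟩
  have := hG (ν j) j rfl (hfst ▸ hmem)
  rw [hAj] at this
  obtain ⟨n, -, hn⟩ := Finset.mem_image.1 this
  rw [Prod.mk.injEq] at hn
  rw [← hn.2, hn.1]

/-- If all families indexed by `ι` are guessed, then dense open sets indexed by `ι` have a common
point. -/
theorem InfinitelyGuessed.exists_forall_mem (H : InfinitelyGuessed ι) {U : ι → Set (ℕ → ℕ)}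
    (hU : ∀ i, IsOpen (U i)) (hd : ∀ i, Dense (U i)) : ∃ x, ∀ i, x ∈ U i := by
  classical
  choose q hq using fun i k =>
    exists_forall_listCylinder_append_subset (hU i) (hd i) (codeBall k)
  choose h hmono hbound using fun i => exists_monotone_code_bound (q i)
  obtain ⟨k, hk, hk0, hY⟩ := H.exists_strictMono hmono (Encodable.encode ([] : List ℕ))
  obtain ⟨G, hG⟩ := H.exists_mem_eq hY fun i n => q i (k n)
  -- A guessed block is appended only if it keeps codes within the next bound. Hence `S n` always
  -- lies in `codeBall (k n)`, for which `q i (k n)` was chosen; correct guesses at `n` in the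
  -- domain of `i` pass this test.
  set fits : ℕ → List ℕ → Prop := fun n r =>
    ∀ s : List ℕ, Encodable.encode s ≤ k n → Encodable.encode (s ++ r) ≤ k (n + 1)
  set S : ℕ → List ℕ := fun n =>
    Nat.rec [] (fun n s => s ++ if fits n (G n) then G n else []) n
  have hS_succ : ∀ n, S (n + 1) = S n ++ if fits n (G n) then G n else [] := fun _ => rfl
  have hS_code : ∀ n, Encodable.encode (S n) ≤ k n := by
    intro n
    induction n with
    | zero => exact hk0.ge
    | succ n ih =>
      rw [hS_succ]
      split_ifs with hfit
      · exact hfit _ ih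
      · rw [List.append_nil]
        exact ih.trans (hk n.lt_succ_self).le
  obtain ⟨x, hx⟩ := exists_forall_mem_listCylinder fun n => (⟨_, rfl⟩ : S n <+: S (n + 1))
  refine ⟨x, fun i => ?_⟩
  obtain ⟨n, hn, hGn⟩ := hG i
  have hfit : fits n (G n) := fun s hs => hGn ▸ (hbound i _ s hs).trans hn
  have hxn := hx (n + 1)
  rw [hS_succ, if_pos hfit, hGn] at hxn
  exact hq i (k n) _ (mem_codeBall.2 (hS_code n)) hxn

end PointInDenseOpenSets

/-! ### Covers by meagre sets and the equivalence -/

theorem exists_dense_open_disjoint_of_isMeagre {M : Set (ℕ → ℕ)} (hM : IsMeagre M) :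
    ∃ U : ℕ → Set (ℕ → ℕ), (∀ n, IsOpen (U n)) ∧ (∀ n, Dense (U n)) ∧ ⋂ n, U n ⊆ Mᶜ := by
  obtain ⟨t, htM, htG, htd⟩ := mem_residual.1 hM
  obtain ⟨U, hU, rfl⟩ := isGδ_iff_eq_iInter_nat.1 htG
  exact ⟨U, hU, fun n => htd.mono (iInter_subset U n), htM⟩

theorem exists_covMeagre_family : ∃ F : Set (Set (ℕ → ℕ)), #F = covMeagre ∧
    (∀ M ∈ F, IsMeagre M) ∧ ⋃₀ F = univ := by
  refine csInf_mem (s := {c | ∃ F : Set (Set (ℕ → ℕ)), #F = c ∧ (∀ M ∈ F, IsMeagre M) ∧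
    ⋃₀ F = univ}) ⟨_, range fun x : ℕ → ℕ => {x}, rfl, ?_, ?_⟩
  · rintro _ ⟨x, rfl⟩
    have : (𝓝[≠] x).NeBot := by
      rw [← mem_closure_iff_nhdsWithin_neBot, mem_closure_iff]
      intro U hU hx
      obtain ⟨n, hn⟩ := exists_initialSegment_subset hU hx
      refine ⟨Function.update x n (x n + 1), hn _ fun i hi => Function.update_of_ne hi.ne _ _, ?_⟩
      intro h
      simpa using congrFun (mem_singleton_iff.1 h) n
    exact residual_of_dense_open isClosed_singleton.isOpen_compl (dense_compl_singleton x)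
  · exact eq_univ_of_forall fun x => ⟨{x}, ⟨x, rfl⟩, rfl⟩

theorem lt_covMeagre_of_infinitelyGuessed {κ : Cardinal.{u}} (hκ : ℵ₀ ≤ κ)
    (H : ∀ ι : Type u, #ι ≤ κ → InfinitelyGuessed ι) :
    κ < Cardinal.lift.{u, 0} covMeagre := by
  by_contra hlt
  obtain ⟨F, hcard, hF, hcover⟩ := exists_covMeagre_family
  choose U hU hd hUM using fun M : F => exists_dense_open_disjoint_of_isMeagre (hF M M.2)
  have hle : #(ULift.{u} (F × ℕ)) ≤ κ := by
    rw [Cardinal.mk_uLift, Cardinal.mk_prod, Cardinal.lift_id, Cardinal.lift_id, Cardinal.lift_mul,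
      hcard]
    refine Cardinal.mul_le_of_le hκ (not_lt.1 hlt) ?_
    rwa [Cardinal.mk_nat, Cardinal.lift_aleph0]
  obtain ⟨x, hx⟩ := (H _ hle).exists_forall_mem (U := fun i => U i.down.1 i.down.2)
    (fun i => hU _ _) fun i => hd _ _
  obtain ⟨M, hM, hxM⟩ : x ∈ ⋃₀ F := hcover ▸ mem_univ x
  exact hUM ⟨M, hM⟩ (mem_iInter.2 fun n => hx ⟨⟨⟨M, hM⟩, n⟩⟩) hxM

end ThetaSelection

open ThetaSelection in
theorem mainTheorem5 (κ : Cardinal.{u}) (hκ : Cardinal.aleph0 ≤ κ) :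
    List.TFAE [
      κ < Cardinal.lift.{u, 0} ThetaSelection.covMeagre,
      ∀ (X : Type u) [TopologicalSpace X] [T1Space X], (∀ y : X, ¬ IsOpen ({y} : Set X)) →
        ∀ x : X, ThetaSelection.thetaTightness x = Cardinal.aleph0 →
          ThetaSelection.thetaCharacter x ≤ κ →
          ¬ ThetaSelection.OneHasWinningStrategy
            (ThetaSelection.thetaOmega x) (ThetaSelection.thetaOmega x),
      ∀ (X : Type u) [TopologicalSpace X] [T1Space X], (∀ y : X, ¬ IsOpen ({y} : Set X)) →
        ∀ x : X, ThetaSelection.thetaTightness x = Cardinal.aleph0 →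
          ThetaSelection.thetaCharacter x ≤ κ →
          ThetaSelection.SelectOne
            (ThetaSelection.thetaOmega x) (ThetaSelection.thetaOmega x)] := by
  tfae_have 1 → 2 := fun h X _ _ _ x ht hχ => not_oneHasWinningStrategy_of_lt_covMeagre h ht hχ
  tfae_have 2 → 3 := fun h X _ _ hX x ht hχ =>
    selectOne_of_not_oneHasWinningStrategy (h X hX x ht hχ)
  tfae_have 3 → 1 := fun h => lt_covMeagre_of_infinitelyGuessed hκ fun ι hι f => by
    have := FilterSpace.t1Space (guessFilter_le_cofinite f)
    exact exists_infinitely_equal_of_selectOne f <| h (FilterSpace (guessFilter f))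
      FilterSpace.not_isOpen_singleton _ (thetaTightness_eq_aleph0_of_countable _)
      ((FilterSpace.thetaCharacter_infty_le (hasBasis_guessFilter f)).trans (mk_guessBasis_le hκ hι))
  tfae_finish
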